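/- Let $\mathsf Z$ be a metric space with its Borel $\sigma$-algebra, let $\mathsf X$ be a separable subset of a real normed space with $\gamma x\in\mathsf X$ for all $x\in\mathsf X$, $\gamma\ge 0$, and put $\mathsf S=\mathsf X\times\mathsf Z$; the action space is $\mathsf A=\mathsf X$. Let $Q$ be a Markov kernel on $\mathsf Z$ with the Feller property ($z\mapsto\int f\,dQ(z,\cdot)$ is continuous for every bounded continuous $f$), $\beta:\mathsf Z\to[0,\infty)$ continuous, $\theta\in(0,1]$, $\Gamma$ a correspondence from $\mathsf S$ to $\mathsf X$, $u$ a real function on the graph of $\Gamma$, and $$H(x,z,a,v)=u(x,z,a)+\beta(z)\int_{\mathsf Z}v(a,z')\,Q(z,dz').$$ Assume the following. (i) $\Gamma$ is continuous (upper and lower hemicontinuous), nonempty and compact valued, and $a\in\Gamma(x,z)$ implies $\gamma a\in\Gamma(\gamma x,z)$ for all $\gamma\ge 0$. The function $u$ is continuous on the graph of $\Gamma$, $u(\gamma x,z,\gamma a)=\gamma^\theta u(x,z,a)$ for all $\gamma\ge0$ and $a\in\Gamma(x,z)$, and there is $B>0$ with $|u(x,z,a)|\le B(\|x\|+\|a\|)^\theta$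 for all $(x,z)\in\mathsf S$, $a\in\Gamma(x,z)$. (ii) There is a bounded measurable $\alpha:\mathsf Z\to[0,\infty)$ with $\|a\|\le\alpha(z)\|x\|$ for all $(x,z)\in\mathsf S$, $a\in\Gamma(x,z)$, such that $\beta\alpha^\theta$ is bounded and the operator $(L_\alpha h)(z)=\beta(z)\alpha(z)^\theta\int h(z')\,Q(z,dz')$ on the space of bounded measurable functions on $\mathsf Z$ with the supremum norm has spectral radius $r(L_\alpha)=\lim_n\|L_\alpha^n\|^{1/n}<1$. Let $\mathcal V$ be the set of continuous $f:\mathsf S\to\mathbb R$ with $f(\gamma x,z)=\gamma^\theta f(x,z)$ for all $\gamma\ge0$ and $\|f\|:=\sup_{z}\sup_{\|x\|=1}|f(x,z)|<\infty$. Let $\Sigma$ be the set of Borel maps $\sigma:\mathsf S\to\mathsf X$ with $\sigma(x,z)\in\Gamma(x,z)$ for all $(x,z)$, and put $(T_\sigma v)(x,z)=H(x,z,\sigma(x,z),v)$, $(Tv)(x,z)=\sup_{a\in\Gamma(x,z)}H(x,z,a,v)$. Then: 1. For every $\sigma\in\Sigma$ the lifetime value $v_\sigma(x,z)=\lim_n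 (T_\sigma^n v_0)(x,z)$ is well defined and finite at every $(x,z)$: for every $v_0\in\mathcal V$ all iterates are measurable, all integrals involved exist, and the limit exists in $\mathbb R$ and does not depend on $v_0\in\mathcal V$. 2. $\Sigma$ is nonempty and $v^*(x,z)=\sup_{\sigma\in\Sigma}v_\sigma(x,z)$ is finite at every $(x,z)$; $T$ maps $\mathcal V$ into $\mathcal V$, and $v^*$ belongs to $\mathcal V$ and is the unique fixed point of $T$ in $\mathcal V$. 3. $\|T^nv-v^*\|\to0$ for every $v\in\mathcal V$. 4. There is an optimal stationary policy, i.e. $\sigma\in\Sigma$ with $v_\sigma=v^*$. 5. (Principle of optimality) A policy $\sigma\in\Sigma$ is optimal if and only if $\sigma(x,z)\in\arg\max_{a\in\Gamma(x,z)}H(x,z,a,v^*)$ for every $(x,z)\in\mathsf S$. -/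

import Mathlib

open MeasureTheory ProbabilityTheory Filter Topology Set
open scoped NNReal ENNReal BoundedContinuousFunction

noncomputable section

/-! ### Bounded measurable functions, discounted transition operators, spectral radius -/

/-- The space of bounded measurable real functions on `Z`, with the supremum norm: the measurable
elements of `ℓ^∞(Z)`. -/
def BoundedMeasurable (Z : Type*) [MeasurableSpace Z] : Submodule ℝ (lp (fun _ : Z => ℝ) ∞) where
  carrier := {h | Measurable fun z => h z}
  add_mem' := fun {f g} hf hg => by
    have h : Measurable fun z => f z + g z := Measurable.add hf hg
    exact h
  zero_mem' := by
    have h : Measurable fun _ : Z => (0 : ℝ) := measurable_const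
    exact h
  smul_mem' := fun r f hf => by
    have h : Measurable fun z => r * f z := Measurable.const_mul hf r
    exact h

namespace BoundedMeasurable

variable {Z : Type*} [MeasurableSpace Z]

instance : CoeFun (BoundedMeasurable Z) (fun _ => Z → ℝ) := ⟨fun h => h.1⟩

lemma measurable (h : BoundedMeasurable Z) : Measurable (h : Z → ℝ) := h.2

lemma abs_le_norm (h : BoundedMeasurable Z) (z : Z) : |h z| ≤ ‖h‖ := by
  have := lp.norm_apply_le_norm (by simp) h.1 z
  simpa using this

/-- A measurable function bounded by a constant, as a member of the space. -/
def mk (f : Z → ℝ) (hf : Measurable f) (hb : ∃ C, ∀ z, |f z| ≤ C) : BoundedMeasurable Z :=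
  ⟨⟨f, memℓp_infty (by
    obtain ⟨C, hC⟩ := hb
    exact ⟨C, by rintro _ ⟨z, rfl⟩; exact hC z⟩)⟩, hf⟩

@[simp] lemma mk_apply (f : Z → ℝ) (hf : Measurable f) (hb : ∃ C, ∀ z, |f z| ≤ C) (z : Z) :
    mk f hf hb z = f z := rfl

lemma norm_le {h : BoundedMeasurable Z} {C : ℝ} (hC : 0 ≤ C) (hh : ∀ z, |h z| ≤ C) : ‖h‖ ≤ C :=
  lp.norm_le_of_forall_le hC hh

lemma integrable (h : BoundedMeasurable Z) (μ : Measure Z) [IsFiniteMeasure μ] :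
    Integrable (h : Z → ℝ) μ :=
  Integrable.of_bound (BoundedMeasurable.measurable h).aestronglyMeasurable ‖h‖
    (Eventually.of_forall fun z => abs_le_norm h z)

lemma abs_integral_le (h : BoundedMeasurable Z) (μ : Measure Z) [IsProbabilityMeasure μ] :
    |∫ z, h z ∂μ| ≤ ‖h‖ := by
  have := norm_integral_le_of_norm_le_const (μ := μ) (f := (h : Z → ℝ)) (C := ‖h‖)
    (Eventually.of_forall fun z => abs_le_norm h z)
  simpa using this

lemma abs_mul_integral_le (c h : BoundedMeasurable Z) (Q : Kernel Z Z) [IsMarkovKernel Q] (z : Z) :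
    |c z * ∫ z', h z' ∂(Q z)| ≤ ‖c‖ * ‖h‖ := by
  rw [abs_mul]
  exact mul_le_mul (abs_le_norm c z) (abs_integral_le h (Q z)) (abs_nonneg _) (norm_nonneg _)

end BoundedMeasurable

/-- The bounded linear operator `(L h)(z) = c(z) ∫ h(z') Q(z, dz')` on bounded measurable
functions, for a bounded measurable coefficient `c` and a Markov kernel `Q`. -/
def discountOperator {Z : Type*} [MeasurableSpace Z] (c : BoundedMeasurable Z) (Q : Kernel Z Z)
    [IsMarkovKernel Q] : BoundedMeasurable Z →L[ℝ] BoundedMeasurable Z :=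
  LinearMap.mkContinuous
    { toFun := fun h => BoundedMeasurable.mk (fun z => c z * ∫ z', h z' ∂(Q z))
        ((BoundedMeasurable.measurable c).mul
          ((BoundedMeasurable.measurable h).stronglyMeasurable.integral_kernel (κ := Q)).measurable)
        ⟨‖c‖ * ‖h‖, fun z => BoundedMeasurable.abs_mul_integral_le c h Q z⟩
      map_add' := fun f g => by
        refine Subtype.ext (Subtype.ext (funext fun z => ?_))
        change c z * ∫ z', (f z' + g z') ∂(Q z)
          = c z * ∫ z', f z' ∂(Q z) + c z * ∫ z', g z' ∂(Q z)
        rw [integral_add (BoundedMeasurable.integrable f _) (BoundedMeasurable.integrable g _), mul_add]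
      map_smul' := fun r f => by
        refine Subtype.ext (Subtype.ext (funext fun z => ?_))
        change c z * ∫ z', r * f z' ∂(Q z) = r * (c z * ∫ z', f z' ∂(Q z))
        rw [integral_const_mul]
        ring }
    ‖c‖
    (fun h => BoundedMeasurable.norm_le (mul_nonneg (norm_nonneg _) (norm_nonneg _))
      fun z => BoundedMeasurable.abs_mul_integral_le c h Q z)

@[simp] lemma discountOperator_apply {Z : Type*} [MeasurableSpace Z] (c : BoundedMeasurable Z)
    (Q : Kernel Z Z) [IsMarkovKernel Q] (h : BoundedMeasurable Z) (z : Z) :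
    discountOperator c Q h z = c z * ∫ z', h z' ∂(Q z) := rfl

/-- `r` is the spectral radius of the bounded operator `L`, in Gelfand's form
`r = lim ‖L ^ n‖ ^ (1 / n)` (this limit exists for every bounded operator). -/
def IsSpectralRadius {V : Type*} [NormedAddCommGroup V] [NormedSpace ℝ V] (L : V →L[ℝ] V)
    (r : ℝ) : Prop :=
  Tendsto (fun n : ℕ => ‖L ^ n‖ ^ (1 / (n : ℝ))) atTop (𝓝 r)

/-- The Feller property: the kernel maps bounded continuous functions to continuous ones. -/
def IsFeller {Z : Type*} [TopologicalSpace Z] [MeasurableSpace Z] (Q : Kernel Z Z) : Prop :=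
  ∀ f : Z →ᵇ ℝ, Continuous fun z => ∫ z', f z' ∂(Q z)

/-! ### Dynamic programs whose action is the next endogenous state -/

/-- The primitives of a dynamic program with state space `X × Z`, action space `X` and aggregator
`u(x, z, a) + β(z) ∫ v(a, z') Q(z, dz')`. Here `X` is a cone in `E` (a subset closed under
multiplication by nonnegative reals). Only the values of `u` at feasible `(x, z, a)` matter. -/
structure ConeProgram {E : Type*} [NormedAddCommGroup E] [NormedSpace ℝ E] [MeasurableSpace E]
    (X : SubMulAction ℝ≥0 E) (Z : Type*) [MeasurableSpace Z] where
  /-- the feasible correspondence -/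
  Γ : X × Z → Set X
  /-- the return function -/
  u : X × Z → X → ℝ
  /-- the state-dependent discount factor -/
  β : Z → ℝ
  /-- the transition kernel of the exogenous state -/
  Q : Kernel Z Z

namespace ConeProgram

variable {E : Type*} [NormedAddCommGroup E] [NormedSpace ℝ E] [MeasurableSpace E]
  {X : SubMulAction ℝ≥0 E} {Z : Type*} [MeasurableSpace Z]

/-- The aggregator `H(x, z, a, v) = u(x, z, a) + β(z) ∫ v(a, z') Q(z, dz')`. -/
def aggregator (D : ConeProgram X Z) (s : X × Z) (a : X) (v : X × Z → ℝ) : ℝ :=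
  D.u s a + D.β s.2 * ∫ z', v (a, z') ∂(D.Q s.2)

/-- The graph of the feasible correspondence. -/
def graph (D : ConeProgram X Z) : Set ((X × Z) × X) := {p | p.2 ∈ D.Γ p.1}

/-- The feasible (stationary) policies: measurable selections of the feasible correspondence. -/
def Policy (D : ConeProgram X Z) : Type _ :=
  {σ : X × Z → X // Measurable σ ∧ ∀ s, σ s ∈ D.Γ s}

/-- The policy operator `(T_σ v)(x, z) = H(x, z, σ(x, z), v)`. -/
def policyOp (D : ConeProgram X Z) (σ : D.Policy) (v : X × Z → ℝ) : X × Z → ℝ :=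
  fun s => D.aggregator s (σ.1 s) v

/-- The Bellman operator `(T v)(x, z) = sup_{a ∈ Γ(x, z)} H(x, z, a, v)`. -/
def bellmanOp (D : ConeProgram X Z) (v : X × Z → ℝ) : X × Z → ℝ :=
  fun s => ⨆ a : D.Γ s, D.aggregator s a v

/-- The lifetime value `v_σ = lim T_σ ^ n v₀`, here with the terminal value `v₀ = 0`. -/
def lifetimeValue (D : ConeProgram X Z) (σ : D.Policy) : X × Z → ℝ :=
  fun s => limUnder atTop fun n : ℕ => ((D.policyOp σ)^[n] 0) s

/-- The lifetime value of `σ` is well defined relative to the candidate class `V`: for every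
terminal value `v₀ ∈ V`, the iterates of `T_σ` are measurable, the integrals occurring in them
exist, and they converge at every state to a real number that does not depend on `v₀`. -/
def LifetimeValueWellDefined (D : ConeProgram X Z) (V : Set (X × Z → ℝ)) (σ : D.Policy) : Prop :=
  ∀ v₀ ∈ V,
    (∀ n : ℕ, Measurable ((D.policyOp σ)^[n] v₀)) ∧
    (∀ (n : ℕ) (a : X) (z : Z), Integrable (fun z' => ((D.policyOp σ)^[n] v₀) (a, z')) (D.Q z)) ∧
    ∀ s, Tendsto (fun n : ℕ => ((D.policyOp σ)^[n] v₀) s) atTop (𝓝 (D.lifetimeValue σ s))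

/-- The value function `v* = sup_σ v_σ`. -/
def valueFunction (D : ConeProgram X Z) : X × Z → ℝ :=
  fun s => ⨆ σ : D.Policy, D.lifetimeValue σ s

/-- A policy is optimal if its lifetime value is the value function. -/
def IsOptimal (D : ConeProgram X Z) (σ : D.Policy) : Prop :=
  ∀ s, D.lifetimeValue σ s = D.valueFunction s

end ConeProgram

/-! ### Homogeneous candidate value functions -/

/-- The norm `sup_z sup_{‖x‖ = 1} |f(x, z)|`. -/
def sphereNorm {E : Type*} [NormedAddCommGroup E] [NormedSpace ℝ E] {X : SubMulAction ℝ≥0 E}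
    {Z : Type*} (f : X × Z → ℝ) : ℝ :=
  ⨆ p : {p : X × Z // ‖(p.1 : E)‖ = 1}, |f p.1|

/-- The continuous functions on `X × Z` that are homogeneous of degree `θ` in `x`, and bounded on
the set where `‖x‖ = 1`. -/
def homogeneousFunctions {E : Type*} [NormedAddCommGroup E] [NormedSpace ℝ E]
    (X : SubMulAction ℝ≥0 E) (Z : Type*) [TopologicalSpace Z] (θ : ℝ) : Set (X × Z → ℝ) :=
  {f | Continuous f ∧
    (∀ (γ : ℝ≥0) (x : X) (z : Z), f (γ • x, z) = (γ : ℝ) ^ θ * f (x, z)) ∧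
    ∃ C : ℝ, ∀ (x : X) (z : Z), ‖(x : E)‖ = 1 → |f (x, z)| ≤ C}

end

/-! Measure functions on `X × Z` against the weight `‖x‖ ^ θ`. Since a feasible action has `‖a‖ ≤
α(z)‖x‖`, one discounting step turns a difference bound `h(z)‖x‖ ^ θ` into `(L h)(z)‖x‖ ^ θ`, where
`L = discountOperator c D.Q`. Both the policy operators and the Bellman operator `T` obey this
(`IsWeightedContraction`), so `n` steps cost `L ^ n`. A spectral radius below one makes `‖L ^ n‖`
summable: iterates are Cauchy relative to the weight and forget the terminal value, although a
single step need not contract.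

`T` acts on the continuous homogeneous functions. Its continuity is Berge's theorem applied to the
aggregator, whose integral term must be jointly continuous in `(a, z)`; the Feller property speaks
only of bounded functions of `z'`, and sup-convolution bridges the gap. Policy operators act on the
larger class of measurable functions of the same growth, because a policy is merely measurable and
need not preserve continuity or homogeneity.

Let `w` be the fixed point of `T`. Then `T_σ w ≤ T w = w`, and monotonicity gives `v_σ ≤ w`. A
measurable selection of maximizers gives `T_σ w = w`, hence `v_σ = w`. So `w = v*`, and `σ` is
optimal exactly when `T_σ w = w`. -/

/-! ### Parametric maximization over a continuous compact-valued correspondence -/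

section Berge

variable {S A : Type*} [TopologicalSpace S] [TopologicalSpace A] {Γ : S → Set A} {F : S × A → ℝ}

/-- A function continuous on the graph has upper semicontinuous maxima over an upper hemicontinuous
compact-valued correspondence, also when the choices are restricted to a closed set. -/
lemma isClosed_setOf_exists_le_of_upperHemicontinuous (hΓ : UpperHemicontinuous Γ)
    (hc : ∀ s, IsCompact (Γ s)) (hF : ContinuousOn F {p | p.2 ∈ Γ p.1}) {C : Set A}
    (hC : IsClosed C) (t : ℝ) : IsClosed {s | ∃ a ∈ Γ s, a ∈ C ∧ t ≤ F (s, a)} := by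
  rw [← isOpen_compl_iff, isOpen_iff_mem_nhds]
  intro s₀ hs₀
  simp only [mem_compl_iff, mem_ofPred_eq, not_exists, not_and, not_le] at hs₀
  -- Tube argument: the strict inequality holds around the compact fibre over `s₀`, hence on a
  -- product neighbourhood, and upper hemicontinuity keeps nearby fibres inside it.
  have h : {p : S × A | p.2 ∈ Γ p.1 → p.2 ∈ C → F p < t} ∈ 𝓝ˢ ({s₀} ×ˢ Γ s₀) := by
    rw [mem_nhdsSet_iff_forall]
    rintro ⟨s, a⟩ ⟨rfl, ha⟩
    by_cases haC : a ∈ C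
    · have := (hF (s, a) ha).eventually_lt_const (hs₀ a ha haC)
      rw [eventually_nhdsWithin_iff] at this
      filter_upwards [this] with p hp h1 _ using hp h1
    · have : ∀ᶠ p : S × A in 𝓝 (s, a), p.2 ∈ Cᶜ :=
        continuousAt_snd.eventually_mem (hC.isOpen_compl.mem_nhds haC)
      filter_upwards [this] with p hp _ h2 using absurd h2 hp
  rw [isCompact_singleton.nhdsSet_prod_eq (hc s₀), nhdsSet_singleton, mem_prod_iff] at h
  obtain ⟨U, hU, V, hV, hUV⟩ := h
  obtain ⟨W, hW, hΓW, hWV⟩ := mem_nhdsSet_iff_exists.1 hV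
  filter_upwards [hU, hΓ.forall_isOpen s₀ W hW hΓW] with s hs hsW
  simp only [mem_compl_iff, mem_ofPred_eq, not_exists, not_and, not_le]
  exact fun a ha haC => hUV (mk_mem_prod hs (hWV (hsW ha))) ha haC

/-- `F` stays above `t` on the graph near a good pair, and lower hemicontinuity supplies feasible
actions near the good one. -/
lemma isOpen_setOf_exists_lt_of_lowerHemicontinuous (hΓ : LowerHemicontinuous Γ)
    (hF : ContinuousOn F {p | p.2 ∈ Γ p.1}) (t : ℝ) :
    IsOpen {s | ∃ a ∈ Γ s, t < F (s, a)} := by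
  rw [isOpen_iff_mem_nhds]
  rintro s₀ ⟨a, ha, hta⟩
  have := (hF (s₀, a) ha).eventually_const_lt hta
  rw [eventually_nhdsWithin_iff, nhds_prod_eq] at this
  obtain ⟨U, hU, V, hV, hUV⟩ := mem_prod_iff.1 this
  obtain ⟨W, hWV, hW, haW⟩ := mem_nhds_iff.1 hV
  have hopen := lowerHemicontinuous_iff_isOpen_inter_nonempty.1 hΓ W hW
  filter_upwards [hU, hopen.mem_nhds ⟨a, ha, haW⟩] with s hs ⟨b, hb, hbW⟩
  exact ⟨b, hb, hUV (mk_mem_prod hs (hWV hbW)) hb⟩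

lemma isGreatest_iSup_of_continuousOn_graph (hc : ∀ s, IsCompact (Γ s))
    (hn : ∀ s, (Γ s).Nonempty) (hF : ContinuousOn F {p | p.2 ∈ Γ p.1}) (s : S) :
    IsGreatest ((fun a => F (s, a)) '' Γ s) (⨆ a : Γ s, F (s, a)) := by
  have hFs : ContinuousOn (fun a => F (s, a)) (Γ s) :=
    hF.comp (Continuous.prodMk_right s).continuousOn fun a ha => ha
  have := ((hc s).image_of_continuousOn hFs).isGreatest_sSup ((hn s).image _)
  rwa [sSup_image'] at this

/-- Berge's maximum theorem: the maximum is a continuous function of the parameter. -/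
lemma continuous_iSup_of_hemicontinuous (hu : UpperHemicontinuous Γ) (hl : LowerHemicontinuous Γ)
    (hc : ∀ s, IsCompact (Γ s)) (hn : ∀ s, (Γ s).Nonempty)
    (hF : ContinuousOn F {p | p.2 ∈ Γ p.1}) : Continuous fun s => ⨆ a : Γ s, F (s, a) := by
  have hg := isGreatest_iSup_of_continuousOn_graph hc hn hF
  refine OrderTopology.continuous_iff.2 fun t => ⟨?_, ?_⟩
  · convert isOpen_setOf_exists_lt_of_lowerHemicontinuous hl hF t using 1
    ext s
    constructor
    · intro h
      obtain ⟨a, ha, hEq⟩ := (hg s).1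
      exact ⟨a, ha, lt_of_lt_of_eq h hEq.symm⟩
    · rintro ⟨a, ha, h⟩
      exact h.trans_le ((hg s).2 ⟨a, ha, rfl⟩)
  · rw [← isClosed_compl_iff]
    convert isClosed_setOf_exists_le_of_upperHemicontinuous hu hc hF isClosed_univ t using 1
    ext s
    simp only [mem_compl_iff, mem_preimage, mem_Iio, not_lt, mem_ofPred_eq, mem_univ, true_and]
    constructor
    · intro h
      obtain ⟨a, ha, hEq⟩ := (hg s).1
      exact ⟨a, ha, by simpa only [hEq] using h⟩
    · rintro ⟨a, ha, h⟩
      exact h.trans ((hg s).2 ⟨a, ha, rfl⟩)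

end Berge

/-! ### Measurable selections of compact-valued correspondences -/

section Selection

variable {S A : Type*}

/-- The minimizers of `f` in the values of a correspondence. -/
def minimizers (f : A → ℝ) (K : S → Set A) (s : S) : Set A := {a ∈ K s | ∀ b ∈ K s, f a ≤ f b}

/-- Successive minimization of a sequence of functions. -/
def iteratedMinimizers (f : ℕ → A → ℝ) (K : S → Set A) : ℕ → S → Set A
  | 0 => K
  | n + 1 => minimizers (f n) (iteratedMinimizers f K n)

variable [TopologicalSpace A] {f : A → ℝ} {K : S → Set A}

lemma minimizers_nonempty (hf : Continuous f) {s : S} (hc : IsCompact (K s))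
    (hn : (K s).Nonempty) : (minimizers f K s).Nonempty :=
  let ⟨a, ha, h⟩ := hc.exists_isMinOn hn hf.continuousOn
  ⟨a, ha, fun _ hb => h hb⟩

lemma isCompact_minimizers (hf : Continuous f) {s : S} (hc : IsCompact (K s)) :
    IsCompact (minimizers f K s) := by
  have : minimizers f K s = K s ∩ ⋂ b ∈ K s, {a | f a ≤ f b} := by
    ext a; simp [minimizers]
  rw [this]
  exact hc.inter_right (isClosed_biInter fun b _ => isClosed_le hf continuous_const)

/-- By compactness, `C` contains a minimizer iff `K s ∩ C` is nonempty and no rational `q` separates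
the minimum over `K s` from the minimum over `K s ∩ C`. This is a countable condition on sets
already known to be measurable. -/
lemma measurableSet_minimizers_inter [MeasurableSpace S] (hf : Continuous f) (hc : ∀ s, IsCompact (K s))
    (hK : ∀ C, IsClosed C → MeasurableSet {s | (K s ∩ C).Nonempty}) {C : Set A} (hC : IsClosed C) :
    MeasurableSet {s | (minimizers f K s ∩ C).Nonempty} := by
  have hle (q : ℚ) : IsClosed {a | f a ≤ q} := isClosed_le hf continuous_const
  have : {s | (minimizers f K s ∩ C).Nonempty} = {s | (K s ∩ C).Nonempty} ∩
      ⋂ q : ℚ, ({s | (K s ∩ {a | f a ≤ q}).Nonempty}ᶜ ∪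
        {s | (K s ∩ (C ∩ {a | f a ≤ q})).Nonempty}) := by
    ext s
    simp only [mem_inter_iff, mem_iInter, mem_union, mem_compl_iff, mem_ofPred_eq]
    constructor
    · rintro ⟨a, ⟨haK, hmin⟩, haC⟩
      refine ⟨⟨a, haK, haC⟩, fun q => or_iff_not_imp_left.2 fun h => ?_⟩
      obtain ⟨b, hbK, hb⟩ := not_not.1 h
      exact ⟨a, haK, haC, (hmin b hbK).trans hb⟩
    · rintro ⟨hne, h⟩
      obtain ⟨a, ⟨haK, haC⟩, hmin⟩ :=
        ((hc s).inter_right hC).exists_isMinOn hne hf.continuousOn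
      refine ⟨a, ⟨haK, fun b hb => ?_⟩, haC⟩
      by_contra! hlt
      obtain ⟨q, hbq, hqa⟩ := exists_rat_btwn hlt
      rcases h q with h | ⟨a', ha'K, ha'C, ha'⟩
      · exact h ⟨b, hb, hbq.le⟩
      · exact absurd (hqa.trans_le (hmin ⟨ha'K, ha'C⟩)) (not_lt.2 ha')
  rw [this]
  exact (hK C hC).inter (MeasurableSet.iInter fun q =>
    (hK _ (hle q)).compl.union (hK _ (hC.inter (hle q))))

/-- A compact-valued correspondence into a separable metrizable space, for which the set of
parameters where its value meets a given closed set is measurable, has a measurable selection. -/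
theorem exists_measurable_selection [MeasurableSpace S] {A : Type*} [MetricSpace A] [TopologicalSpace.SeparableSpace A]
    [MeasurableSpace A] [BorelSpace A] {K : S → Set A} (hn : ∀ s, (K s).Nonempty)
    (hc : ∀ s, IsCompact (K s))
    (hK : ∀ C, IsClosed C → MeasurableSet {s | (K s ∩ C).Nonempty}) :
    ∃ σ : S → A, Measurable σ ∧ ∀ s, σ s ∈ K s := by
  rcases isEmpty_or_nonempty S with hS | ⟨⟨s₀⟩⟩
  · exact ⟨isEmptyElim, measurable_of_empty _, isEmptyElim⟩
  have : Nonempty A := ⟨(hn s₀).some⟩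
  -- Distances to a dense sequence separate points, so minimizing them one after another cuts each
  -- compact value down to a single point.
  set f : ℕ → A → ℝ := fun n a => dist a (TopologicalSpace.denseSeq A n) with hf_def
  have hf (n) : Continuous (f n) := continuous_id.dist continuous_const
  set J := iteratedMinimizers f K
  have hJc (n) : ∀ s, IsCompact (J n s) := by
    induction n with
    | zero => exact hc
    | succ n ih => exact fun s => isCompact_minimizers (hf n) (ih s)
  have hJn (n) : ∀ s, (J n s).Nonempty := by
    induction n with
    | zero => exact hn
    | succ n ih => exact fun s => minimizers_nonempty (hf n) (hJc n s) (ih s)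
  have hJm (n) : ∀ C, IsClosed C → MeasurableSet {s | (J n s ∩ C).Nonempty} := by
    induction n with
    | zero => exact hK
    | succ n ih => exact fun C hC => measurableSet_minimizers_inter (hf n) (hJc n) ih hC
  have hJs (n s) : J (n + 1) s ⊆ J n s := fun a ha => ha.1
  have hmeet (s) {C : Set A} (hC : IsClosed C) (h : ∀ n, (J n s ∩ C).Nonempty) :
      (⋂ n, J n s ∩ C).Nonempty :=
    IsCompact.nonempty_iInter_of_sequence_nonempty_isCompact_isClosed (fun n => J n s ∩ C)
      (fun n => inter_subset_inter_left _ (hJs n s)) h ((hJc 0 s).inter_right hC)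
      fun n => (hJc n s).isClosed.inter hC
  have hex (s) : ∃ a, ∀ n, a ∈ J n s := by
    obtain ⟨a, ha⟩ := hmeet s isClosed_univ fun n => by simpa using hJn n s
    exact ⟨a, fun n => (mem_iInter.1 ha n).1⟩
  choose σ hσ using hex
  have huniq (s a) (ha : ∀ n, a ∈ J n s) : a = σ s := by
    have h (n) : f n a = f n (σ s) :=
      le_antisymm ((ha (n + 1)).2 _ (hσ s n)) ((hσ s (n + 1)).2 _ (ha n))
    refine dist_le_zero.1 (le_of_forall_pos_le_add fun ε hε => ?_)
    obtain ⟨n, hn⟩ := (TopologicalSpace.denseRange_denseSeq A).exists_dist_lt a (half_pos hε)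
    have h1 := h n
    simp only [hf_def] at h1
    have h2 := dist_triangle_right a (σ s) (TopologicalSpace.denseSeq A n)
    linarith
  refine ⟨σ, measurable_of_isClosed fun C hC => ?_, fun s => hσ s 0⟩
  -- Nested compact sets that all meet `C` have a common point in `C`, and that point can only be `σ
  -- s`.
  have : σ ⁻¹' C = ⋂ n, {s | (J n s ∩ C).Nonempty} := by
    ext s
    simp only [mem_preimage, mem_iInter, mem_ofPred_eq]
    refine ⟨fun h n => ⟨σ s, hσ s n, h⟩, fun h => ?_⟩
    obtain ⟨a, ha⟩ := hmeet s hC h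
    rw [← huniq s a fun n => (mem_iInter.1 ha n).1]
    exact (mem_iInter.1 ha 0).2
  rw [this]
  exact MeasurableSet.iInter fun n => hJm n C hC

end Selection

/-! ### Joint continuity of integrals against a Feller kernel -/

section Feller

variable {A Z : Type*} [PseudoMetricSpace A] [PseudoMetricSpace Z]

/-- The sup-convolution `z' ↦ sup (v(a, z) - k d(z, z') - k d(a, a₀))` over `a` in a ball around
`a₀`. -/
noncomputable def supConvolution (v : A × Z → ℝ) (a₀ : A) (δ k : ℝ) (z' : Z) : ℝ :=
  ⨆ q : {q : A × Z // dist q.1 a₀ < δ}, (v q.1 - k * (dist q.1.2 z' + dist q.1.1 a₀))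

variable {v : A × Z → ℝ} {a₀ : A} {δ k C : ℝ}

lemma bddAbove_supConvolution (hk : 0 ≤ k) (hb : ∀ a, dist a a₀ < δ → ∀ z, |v (a, z)| ≤ C)
    (z' : Z) : BddAbove (range fun q : {q : A × Z // dist q.1 a₀ < δ} =>
      v q.1 - k * (dist q.1.2 z' + dist q.1.1 a₀)) := by
  refine ⟨C, ?_⟩
  rintro _ ⟨⟨⟨a, z⟩, hq⟩, rfl⟩
  have h1 := (abs_le.1 (hb a hq z)).2
  have h2 : 0 ≤ k * (dist z z' + dist a a₀) := by positivity
  simp only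
  linarith

/-- Testing the supremum at `(a, z')` leaves only the penalty in `a`, so one function of `z'`
majorizes all nearby slices of `v` up to a small error. -/
lemma le_supConvolution (hk : 0 ≤ k) (hb : ∀ a, dist a a₀ < δ → ∀ z, |v (a, z)| ≤ C)
    {a : A} (ha : dist a a₀ < δ) (z' : Z) :
    v (a, z') ≤ supConvolution v a₀ δ k z' + k * dist a a₀ := by
  have := le_ciSup (bddAbove_supConvolution hk hb z') ⟨(a, z'), ha⟩
  simp only [dist_self, zero_add] at this
  unfold supConvolution
  linarith

lemma supConvolution_le (hδ : 0 < δ) (hk : 0 ≤ k)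
    (hb : ∀ a, dist a a₀ < δ → ∀ z, |v (a, z)| ≤ C) (z' : Z) : supConvolution v a₀ δ k z' ≤ C := by
  have : Nonempty {q : A × Z // dist q.1 a₀ < δ} := ⟨⟨(a₀, z'), by simpa using hδ⟩⟩
  refine ciSup_le ?_
  rintro ⟨⟨a, z⟩, hq⟩
  have h1 := (abs_le.1 (hb a hq z)).2
  have h2 : 0 ≤ k * (dist z z' + dist a a₀) := by positivity
  simp only
  linarith

lemma apply_le_supConvolution (hδ : 0 < δ) (hk : 0 ≤ k)
    (hb : ∀ a, dist a a₀ < δ → ∀ z, |v (a, z)| ≤ C) (z' : Z) :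
    v (a₀, z') ≤ supConvolution v a₀ δ k z' := by
  simpa using le_supConvolution hk hb (a := a₀) (by simpa using hδ) z'

lemma abs_supConvolution_le (hδ : 0 < δ) (hk : 0 ≤ k)
    (hb : ∀ a, dist a a₀ < δ → ∀ z, |v (a, z)| ≤ C) (z' : Z) :
    |supConvolution v a₀ δ k z'| ≤ C :=
  abs_le.2 ⟨(abs_le.1 (hb a₀ (by simpa using hδ) z')).1.trans
    (apply_le_supConvolution hδ hk hb z'), supConvolution_le hδ hk hb z'⟩

lemma continuous_supConvolution (hδ : 0 < δ) (hk : 0 ≤ k)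
    (hb : ∀ a, dist a a₀ < δ → ∀ z, |v (a, z)| ≤ C) : Continuous (supConvolution v a₀ δ k) := by
  refine (LipschitzWith.of_le_add_mul k.toNNReal fun z z' => ?_).continuous
  rw [Real.coe_toNNReal k hk]
  have : Nonempty {q : A × Z // dist q.1 a₀ < δ} := ⟨⟨(a₀, z), by simpa using hδ⟩⟩
  refine ciSup_le fun q => ?_
  have h1 : v q.1 - k * (dist q.1.2 z' + dist q.1.1 a₀) ≤ supConvolution v a₀ δ k z' :=
    le_ciSup (bddAbove_supConvolution hk hb z') q
  have h2 := mul_le_mul_of_nonneg_left (dist_triangle q.1.2 z z') hk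
  linarith

lemma tendsto_supConvolution (hv : Continuous v) (hδ : 0 < δ)
    (hb : ∀ a, dist a a₀ < δ → ∀ z, |v (a, z)| ≤ C) (z' : Z) :
    Tendsto (fun k : ℕ => supConvolution v a₀ δ k z') atTop (𝓝 (v (a₀, z'))) := by
  rw [tendsto_order]
  refine ⟨fun b hb' => Eventually.of_forall fun k =>
    hb'.trans_le (apply_le_supConvolution hδ k.cast_nonneg hb z'), fun b hb' => ?_⟩
  obtain ⟨t, htv, htb⟩ := exists_between hb'
  obtain ⟨η, hη, hball⟩ := Metric.eventually_nhds_iff.1 (hv.continuousAt.eventually_lt_const htv)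
  -- `2 * C` bounds the oscillation of `v` over the ball, so beyond this `k` a point at distance at
  -- least `η` loses at least what it could gain.
  have hlarge : ∀ᶠ k : ℕ in atTop, 2 * C ≤ k * η :=
    (tendsto_natCast_atTop_atTop.atTop_mul_const hη).eventually_ge_atTop _
  filter_upwards [hlarge] with k hk
  have : Nonempty {q : A × Z // dist q.1 a₀ < δ} := ⟨⟨(a₀, z'), by simpa using hδ⟩⟩
  refine (ciSup_le ?_).trans_lt htb
  rintro ⟨⟨a, z⟩, hq⟩
  simp only
  by_cases hd : dist (a, z) (a₀, z') < η
  · have h1 := hball hd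
    have h2 : 0 ≤ (k : ℝ) * (dist z z' + dist a a₀) := by positivity
    linarith
  · rw [not_lt, Prod.dist_eq] at hd
    have h1 : η ≤ dist z z' + dist a a₀ :=
      hd.trans (max_le (by linarith [dist_nonneg (x := z) (y := z')])
        (by linarith [dist_nonneg (x := a) (y := a₀)]))
    have h2 := mul_le_mul_of_nonneg_left h1 (k.cast_nonneg (α := ℝ))
    have h3 := (abs_le.1 (hb a hq z)).2
    have h4 := (abs_le.1 (hb a₀ (by simpa using hδ) z')).1
    linarith

variable [MeasurableSpace Z] [BorelSpace Z]

/-- Dominated convergence gives a `k` for which the sup-convolution still integrates to less than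
`t` at `z₀`. With `k` fixed it is bounded and continuous, so the Feller property moves `z`, while
the error `k * dist a a₀` handles `a`. -/
lemma IsFeller.eventually_integral_lt {Q : Kernel Z Z} [IsMarkovKernel Q] (hQ : IsFeller Q)
    (hv : Continuous v) (hδ : 0 < δ) (hb : ∀ a, dist a a₀ < δ → ∀ z, |v (a, z)| ≤ C) (z₀ : Z)
    {t : ℝ} (ht : ∫ z', v (a₀, z') ∂(Q z₀) < t) :
    ∀ᶠ p : A × Z in 𝓝 (a₀, z₀), ∫ z', v (p.1, z') ∂(Q p.2) < t := by
  have hcont (k : ℕ) := continuous_supConvolution hδ k.cast_nonneg hb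
  have hlim : Tendsto (fun k : ℕ => ∫ z', supConvolution v a₀ δ k z' ∂(Q z₀)) atTop
      (𝓝 (∫ z', v (a₀, z') ∂(Q z₀))) :=
    tendsto_integral_of_dominated_convergence (fun _ => C)
      (fun k => (hcont k).measurable.aestronglyMeasurable) (integrable_const C)
      (fun k => Eventually.of_forall fun z' => abs_supConvolution_le hδ k.cast_nonneg hb z')
      (Eventually.of_forall (tendsto_supConvolution hv hδ hb))
  obtain ⟨k, hk⟩ := (hlim.eventually_lt_const ht).exists
  set g : Z →ᵇ ℝ := BoundedContinuousFunction.ofNormedAddCommGroup (supConvolution v a₀ δ k)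
    (hcont k) C (abs_supConvolution_le hδ k.cast_nonneg hb) with hg
  have hupper : ContinuousAt (fun p : A × Z => ∫ z', g z' ∂(Q p.2) + k * dist p.1 a₀) (a₀, z₀) :=
    (((hQ g).comp continuous_snd).add
      (continuous_const.mul (continuous_fst.dist continuous_const))).continuousAt
  have hnear : ∀ᶠ p : A × Z in 𝓝 (a₀, z₀), dist p.1 a₀ < δ :=
    (continuous_fst.dist continuous_const).continuousAt.eventually_lt_const (by simpa using hδ)
  filter_upwards [hupper.eventually_lt_const (u := t) (by simpa [hg] using hk), hnear] with p hp hpδ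
  refine lt_of_le_of_lt ?_ hp
  have hvi : Integrable (fun z' => v (p.1, z')) (Q p.2) :=
    Integrable.of_bound (hv.comp (Continuous.prodMk_right p.1)).measurable.aestronglyMeasurable C
      (Eventually.of_forall (hb p.1 hpδ))
  have hgi : Integrable (fun z' => g z') (Q p.2) := g.integrable _
  calc ∫ z', v (p.1, z') ∂(Q p.2) ≤ ∫ z', (g z' + k * dist p.1 a₀) ∂(Q p.2) :=
        integral_mono hvi (hgi.add (integrable_const _))
          fun z' => le_supConvolution k.cast_nonneg hb hpδ z'
    _ = ∫ z', g z' ∂(Q p.2) + k * dist p.1 a₀ := by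
        rw [integral_add hgi (integrable_const _)]; simp

/-- For a Feller kernel, `(a, z) ↦ ∫ v(a, z') Q(z, dz')` is jointly continuous when `v` is
continuous and bounded locally in `a`. -/
theorem IsFeller.continuous_integral {Q : Kernel Z Z} [IsMarkovKernel Q] (hQ : IsFeller Q)
    (hv : Continuous v)
    (hb : ∀ a₀, ∃ δ > 0, ∃ C, ∀ a, dist a a₀ < δ → ∀ z, |v (a, z)| ≤ C) :
    Continuous fun p : A × Z => ∫ z', v (p.1, z') ∂(Q p.2) := by
  rw [continuous_iff_continuousAt]
  rintro ⟨a₀, z₀⟩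
  obtain ⟨δ, hδ, C, hC⟩ := hb a₀
  refine tendsto_order.2 ⟨fun t ht => ?_, fun t ht => hQ.eventually_integral_lt hv hδ hC z₀ ht⟩
  -- The lower bound is the upper bound for `-v`.
  have := hQ.eventually_integral_lt (v := fun p => -v p) hv.neg hδ
    (fun a ha z => by simpa using hC a ha z) z₀ (t := -t) (by simpa [integral_neg] using ht)
  simpa [integral_neg] using this

end Feller

/-! ### Operators contracting a weighted distance up to a bounded operator -/

/-- Root test: for `r < q < 1`, eventually `‖L ^ n‖ ≤ q ^ n`. -/
lemma IsSpectralRadius.summable_norm_pow {V : Type*} [NormedAddCommGroup V] [NormedSpace ℝ V]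
    {L : V →L[ℝ] V} {r : ℝ} (h : IsSpectralRadius L r) (hr : r < 1) :
    Summable fun n : ℕ => ‖L ^ n‖ := by
  have hr0 : 0 ≤ r := ge_of_tendsto' h fun n => by positivity
  obtain ⟨q, hrq, hq1⟩ := exists_between hr
  refine Summable.of_norm_bounded_eventually_nat
    (summable_geometric_of_lt_one (hr0.trans hrq.le) hq1) ?_
  filter_upwards [h.eventually_lt_const hrq, eventually_ge_atTop 1] with n hn hn1
  have hn0 : (n : ℝ) ≠ 0 := by positivity
  have := pow_le_pow_left₀ (by positivity) hn.le n
  rwa [← Real.rpow_natCast, ← Real.rpow_mul (norm_nonneg _), one_div_mul_cancel hn0,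
    Real.rpow_one, ← norm_norm] at this

namespace BoundedMeasurable

variable {Z : Type*} [MeasurableSpace Z]

/-- A shortcut for instance search. -/
noncomputable instance : Monoid (BoundedMeasurable Z →L[ℝ] BoundedMeasurable Z) :=
  ContinuousLinearMap.monoidWithZero.toMonoid

/-- The constant function with value `C`. -/
noncomputable def const (C : ℝ) : BoundedMeasurable Z :=
  mk (fun _ => C) measurable_const ⟨|C|, fun _ => le_rfl⟩

@[simp] lemma const_apply (C : ℝ) (z : Z) : const C z = C := rfl

lemma norm_const_le {C : ℝ} (hC : 0 ≤ C) : ‖(const C : BoundedMeasurable Z)‖ ≤ C :=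
  norm_le hC fun _ => (abs_of_nonneg hC).le

end BoundedMeasurable

/-- `P` preserves `K`, and differences of `P` on `K` are controlled by the operator `L`, relative
to the weight `w`. -/
structure IsWeightedContraction {A Z : Type*} [MeasurableSpace Z] (w : A → ℝ)
    (L : BoundedMeasurable Z →L[ℝ] BoundedMeasurable Z) (K : Set (A × Z → ℝ))
    (P : (A × Z → ℝ) → A × Z → ℝ) : Prop where
  weight_nonneg : ∀ a, 0 ≤ w a
  map_nonneg : ∀ h : BoundedMeasurable Z, (∀ z, 0 ≤ h z) → ∀ z, 0 ≤ L h z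
  mapsTo : MapsTo P K K
  abs_sub_le : ∀ v ∈ K, ∀ v' ∈ K, ∀ h : BoundedMeasurable Z, (∀ z, 0 ≤ h z) →
    (∀ a z, |v (a, z) - v' (a, z)| ≤ h z * w a) →
    ∀ a z, |P v (a, z) - P v' (a, z)| ≤ L h z * w a

namespace IsWeightedContraction

variable {A Z : Type*} [MeasurableSpace Z] {w : A → ℝ}
  {L : BoundedMeasurable Z →L[ℝ] BoundedMeasurable Z} {K : Set (A × Z → ℝ)}
  {P : (A × Z → ℝ) → A × Z → ℝ} {v v' : A × Z → ℝ} {C : ℝ}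

lemma iterate_mem (hP : IsWeightedContraction w L K P) (hv : v ∈ K) (n : ℕ) : P^[n] v ∈ K :=
  hP.mapsTo.iterate n hv

lemma pow_nonneg (hP : IsWeightedContraction w L K P) {h : BoundedMeasurable Z}
    (hh : ∀ z, 0 ≤ h z) (n : ℕ) : ∀ z, 0 ≤ (L ^ n) h z := by
  induction n with
  | zero => simpa using hh
  | succ n ih => rw [pow_succ']; exact hP.map_nonneg _ ih

lemma abs_iterate_sub_le (hP : IsWeightedContraction w L K P) (hv : v ∈ K) (hv' : v' ∈ K)
    {h : BoundedMeasurable Z} (hh : ∀ z, 0 ≤ h z)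
    (hd : ∀ a z, |v (a, z) - v' (a, z)| ≤ h z * w a) (n : ℕ) :
    ∀ a z, |P^[n] v (a, z) - P^[n] v' (a, z)| ≤ (L ^ n) h z * w a := by
  induction n with
  | zero => simpa using hd
  | succ n ih =>
    rw [Function.iterate_succ_apply', Function.iterate_succ_apply', pow_succ']
    exact hP.abs_sub_le _ (hP.iterate_mem hv n) _ (hP.iterate_mem hv' n) _ (hP.pow_nonneg hh n) ih

lemma abs_iterate_sub_le_norm (hP : IsWeightedContraction w L K P) (hv : v ∈ K) (hv' : v' ∈ K)
    (hC : 0 ≤ C) (hd : ∀ a z, |v (a, z) - v' (a, z)| ≤ C * w a) (n : ℕ) (a : A) (z : Z) :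
    |P^[n] v (a, z) - P^[n] v' (a, z)| ≤ ‖L ^ n‖ * C * w a := by
  refine (hP.abs_iterate_sub_le hv hv' (h := BoundedMeasurable.const C) (fun _ => hC) hd n a z).trans ?_
  gcongr
  · exact hP.weight_nonneg a
  · exact (le_abs_self _).trans ((BoundedMeasurable.abs_le_norm _ z).trans
      (((L ^ n).le_opNorm _).trans (by gcongr; exact BoundedMeasurable.norm_const_le hC)))

lemma tendsto_iterate_sub (hP : IsWeightedContraction w L K P)
    (hL : Summable fun n : ℕ => ‖L ^ n‖) (hv : v ∈ K) (hv' : v' ∈ K)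
    (hC : 0 ≤ C) (hd : ∀ a z, |v (a, z) - v' (a, z)| ≤ C * w a) (s : A × Z) :
    Tendsto (fun n => P^[n] v s - P^[n] v' s) atTop (𝓝 0) := by
  refine squeeze_zero_norm (fun n => hP.abs_iterate_sub_le_norm hv hv' hC hd n s.1 s.2) ?_
  simpa using (hL.tendsto_atTop_zero.mul_const C).mul_const (w s.1)

/-- The iterates converge, uniformly relative to the weight. -/
lemma exists_limit (hP : IsWeightedContraction w L K P) (hL : Summable fun n : ℕ => ‖L ^ n‖)
    (hv : v ∈ K) (hC : 0 ≤ C) (hd : ∀ a z, |P v (a, z) - v (a, z)| ≤ C * w a) :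
    ∃ (vlim : A × Z → ℝ) (ε : ℕ → ℝ), Tendsto ε atTop (𝓝 0) ∧
      ∀ n a z, |P^[n] v (a, z) - vlim (a, z)| ≤ ε n * w a := by
  have hstep (a : A) (z : Z) (n : ℕ) :
      dist (P^[n] v (a, z)) (P^[n + 1] v (a, z)) ≤ ‖L ^ n‖ * C * w a := by
    rw [dist_comm, Real.dist_eq, Function.iterate_succ_apply]
    exact hP.abs_iterate_sub_le_norm (hP.mapsTo hv) hv hC hd n a z
  have hsum (a : A) : Summable fun n => ‖L ^ n‖ * C * w a := (hL.mul_right C).mul_right (w a)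
  have hlim (s : A × Z) : ∃ y, Tendsto (fun n => P^[n] v s) atTop (𝓝 y) :=
    cauchySeq_tendsto_of_complete
      (cauchySeq_of_dist_le_of_summable _ (hstep s.1 s.2) (hsum s.1))
  choose vlim hvlim using hlim
  -- The tail of the series bounding consecutive distances; the weight factors out, so it does not
  -- depend on the state.
  refine ⟨vlim, fun n => (∑' m, ‖L ^ (n + m)‖) * C, ?_, fun n a z => ?_⟩
  · have := (tendsto_sum_nat_add fun n : ℕ => ‖L ^ n‖).mul_const C
    simpa [add_comm] using this
  · have := dist_le_tsum_of_dist_le_of_tendsto _ (hstep a z) (hsum a) (hvlim (a, z)) n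
    rwa [tsum_mul_right, tsum_mul_right, Real.dist_eq] at this

/-- A weighted-uniform limit of iterates is a fixed point. -/
lemma isFixedPt_limit (hP : IsWeightedContraction w L K P) (hv : v ∈ K) {vlim : A × Z → ℝ}
    (hlim : vlim ∈ K) {ε : ℕ → ℝ} (hε : Tendsto ε atTop (𝓝 0))
    (hd : ∀ n a z, |P^[n] v (a, z) - vlim (a, z)| ≤ ε n * w a) : P vlim = vlim := by
  funext ⟨a, z⟩
  have h1 : Tendsto (fun n => P^[n + 1] v (a, z) - vlim (a, z)) atTop (𝓝 0) := by
    refine squeeze_zero_norm (fun n => hd (n + 1) a z) ?_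
    simpa using ((tendsto_add_atTop_iff_nat 1).2 hε).mul_const (w a)
  -- `P` is Lipschitz relative to the weight with constant `‖L ^ 1‖`; the absolute value is taken
  -- because `ε n` is not assumed nonnegative.
  have hbound (n : ℕ) : |P^[n + 1] v (a, z) - P vlim (a, z)| ≤ ‖L ^ 1‖ * |ε n| * w a := by
    have hd' (a : A) (z : Z) : |P^[n] v (a, z) - vlim (a, z)| ≤ |ε n| * w a :=
      (hd n a z).trans (mul_le_mul_of_nonneg_right (le_abs_self _) (hP.weight_nonneg a))
    rw [Function.iterate_succ_apply']
    simpa only [Function.iterate_one] using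
      hP.abs_iterate_sub_le_norm (hP.iterate_mem hv n) hlim (abs_nonneg (ε n)) hd' 1 a z
  have h2 : Tendsto (fun n => P^[n + 1] v (a, z) - P vlim (a, z)) atTop (𝓝 0) := by
    refine squeeze_zero_norm hbound ?_
    generalize ‖L ^ 1‖ = l
    simpa using (hε.abs.const_mul l).mul_const (w a)
  have h3 := tendsto_nhds_unique tendsto_const_nhds
    ((h1.sub h2).congr fun n => show _ = P vlim (a, z) - vlim (a, z) by ring)
  linarith

lemma eq_of_isFixedPt (hP : IsWeightedContraction w L K P) (hL : Summable fun n : ℕ => ‖L ^ n‖)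
    (hv : v ∈ K) (hv' : v' ∈ K) (hC : 0 ≤ C) (hd : ∀ a z, |v (a, z) - v' (a, z)| ≤ C * w a)
    (h : P v = v) (h' : P v' = v') : v = v' := by
  funext s
  have h1 := hP.tendsto_iterate_sub hL hv hv' hC hd s
  simp only [Function.iterate_fixed h, Function.iterate_fixed h'] at h1
  exact sub_eq_zero.1 (tendsto_nhds_unique tendsto_const_nhds h1)

end IsWeightedContraction

/-! ### Functions of growth `‖x‖ ^ θ` on a cone -/

section Growth

variable {E : Type*} [NormedAddCommGroup E] [NormedSpace ℝ E] {X : SubMulAction ℝ≥0 E}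
  {Z : Type*} {θ : ℝ}

/-- The weight `‖x‖ ^ θ`. -/
noncomputable def coneWeight (X : SubMulAction ℝ≥0 E) (θ : ℝ) (x : X) : ℝ := ‖(x : E)‖ ^ θ

lemma coneWeight_nonneg (x : X) : 0 ≤ coneWeight X θ x := Real.rpow_nonneg (norm_nonneg _) _

lemma continuous_coneWeight (hθ : 0 < θ) : Continuous (coneWeight X θ) :=
  (continuous_norm.comp continuous_subtype_val).rpow_const fun _ => Or.inr hθ.le

lemma coneWeight_eq_zero (hθ : 0 < θ) {x : X} (hx : ‖(x : E)‖ = 0) : coneWeight X θ x = 0 := by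
  rw [coneWeight, hx, Real.zero_rpow hθ.ne']

lemma norm_coe_smul (γ : ℝ≥0) (x : X) : ‖((γ • x : X) : E)‖ = γ * ‖(x : E)‖ := by
  rw [SubMulAction.val_smul, NNReal.smul_def, norm_smul, Real.norm_of_nonneg γ.coe_nonneg]

/-- Homogeneous functions bounded on the unit sphere are bounded by a multiple of the weight. -/
lemma exists_bound_of_mem_homogeneousFunctions [TopologicalSpace Z] (hθ : 0 < θ)
    {v : X × Z → ℝ} (hv : v ∈ homogeneousFunctions X Z θ) :
    ∃ C, 0 ≤ C ∧ ∀ x z, |v (x, z)| ≤ C * coneWeight X θ x := by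
  obtain ⟨-, hhom, C, hC⟩ := hv
  refine ⟨|C|, abs_nonneg C, fun x z => ?_⟩
  -- The zero vector cannot be normalized to the sphere; there homogeneity at `γ = 0` forces the
  -- value zero.
  rcases eq_or_ne ‖(x : E)‖ 0 with hx | hx
  · have h0 : (0 : ℝ≥0) • x = x := Subtype.ext (by
      rw [SubMulAction.val_smul, zero_smul, norm_eq_zero.1 hx])
    have := hhom 0 x z
    rw [h0, NNReal.coe_zero, Real.zero_rpow hθ.ne', zero_mul] at this
    rw [this, abs_zero]
    exact mul_nonneg (abs_nonneg _) (coneWeight_nonneg x)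
  · have hγ : ‖(x : E)‖₊ ≠ 0 := fun h => hx (congrArg NNReal.toReal h)
    have h1 : ‖((‖(x : E)‖₊⁻¹ • x : X) : E)‖ = 1 := by
      rw [norm_coe_smul, NNReal.coe_inv, coe_nnnorm, inv_mul_cancel₀ hx]
    have h2 := hhom ‖(x : E)‖₊ (‖(x : E)‖₊⁻¹ • x) z
    rw [smul_inv_smul₀ hγ] at h2
    rw [h2, coe_nnnorm, abs_mul, abs_of_nonneg (Real.rpow_nonneg (norm_nonneg _) _), mul_comm]
    exact mul_le_mul_of_nonneg_right ((hC _ z h1).trans (le_abs_self C)) (coneWeight_nonneg x)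

lemma zero_mem_homogeneousFunctions [TopologicalSpace Z] :
    (0 : X × Z → ℝ) ∈ homogeneousFunctions X Z θ :=
  ⟨continuous_const, fun _ _ _ => by simp, 0, fun _ _ _ => by simp⟩

/-- Limits that are uniform relative to the weight preserve homogeneous continuous functions. -/
lemma mem_homogeneousFunctions_of_limit [TopologicalSpace Z] (hθ : 0 < θ) {v : ℕ → X × Z → ℝ}
    (hv : ∀ n, v n ∈ homogeneousFunctions X Z θ) {vlim : X × Z → ℝ} {ε : ℕ → ℝ}
    (hε : Tendsto ε atTop (𝓝 0))
    (hd : ∀ n x z, |v n (x, z) - vlim (x, z)| ≤ ε n * coneWeight X θ x) :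
    vlim ∈ homogeneousFunctions X Z θ := by
  have hlim (s : X × Z) : Tendsto (fun n => v n s) atTop (𝓝 (vlim s)) := by
    rw [tendsto_iff_norm_sub_tendsto_zero]
    refine squeeze_zero (fun n => norm_nonneg _) (fun n => hd n s.1 s.2) ?_
    simpa using hε.mul_const (coneWeight X θ s.1)
  refine ⟨?_, fun γ x z => ?_, ?_⟩
  -- The weight is bounded near each point, so convergence relative to it is locally uniform.
  · have : TendstoLocallyUniformly v vlim atTop := by
      rw [Metric.tendstoLocallyUniformly_iff]
      intro η hη s
      have hw : ∀ᶠ p : X × Z in 𝓝 s, coneWeight X θ p.1 < coneWeight X θ s.1 + 1 :=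
        ((continuous_coneWeight hθ).comp continuous_fst).continuousAt.eventually_lt_const
          (lt_add_one _)
      refine ⟨_, hw, ?_⟩
      have h0 : Tendsto (fun n => |ε n| * (coneWeight X θ s.1 + 1)) atTop (𝓝 0) := by
        simpa using hε.abs.mul_const (coneWeight X θ s.1 + 1)
      filter_upwards [h0.eventually_lt_const hη] with n hn p hp
      rw [dist_comm, Real.dist_eq]
      calc |v n p - vlim p| ≤ ε n * coneWeight X θ p.1 := hd n p.1 p.2
        _ ≤ |ε n| * (coneWeight X θ s.1 + 1) :=
          mul_le_mul (le_abs_self _) (le_of_lt hp) (coneWeight_nonneg _) (abs_nonneg _)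
        _ < η := hn
    exact this.continuous (Frequently.of_forall fun n => (hv n).1)
  · exact tendsto_nhds_unique (hlim _)
      (((hlim (x, z)).const_mul _).congr fun n => ((hv n).2.1 γ x z).symm)
  · obtain ⟨C, hC⟩ := (hv 0).2.2
    refine ⟨C + ε 0, fun x z hx => ?_⟩
    have h1 := hd 0 x z
    rw [coneWeight, hx, Real.one_rpow, mul_one, abs_sub_comm] at h1
    have h2 := abs_sub_abs_le_abs_sub (vlim (x, z)) (v 0 (x, z))
    linarith [hC x z hx]

lemma sphereNorm_nonneg (f : X × Z → ℝ) : 0 ≤ sphereNorm f :=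
  Real.iSup_nonneg fun _ => abs_nonneg _

lemma sphereNorm_le {f : X × Z → ℝ} {C : ℝ} (hC : 0 ≤ C)
    (hf : ∀ x z, |f (x, z)| ≤ C * coneWeight X θ x) : sphereNorm f ≤ C :=
  Real.iSup_le (fun p => by
    have := hf p.1.1 p.1.2
    rwa [coneWeight, p.2, Real.one_rpow, mul_one] at this) hC

variable [MeasurableSpace E] [MeasurableSpace Z]

/-- The measurable functions bounded by a multiple of `‖x‖ ^ θ`. -/
def growthClass (X : SubMulAction ℝ≥0 E) (Z : Type*) [MeasurableSpace Z] (θ : ℝ) :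
    Set (X × Z → ℝ) :=
  {v | Measurable v ∧ ∃ C, 0 ≤ C ∧ ∀ x z, |v (x, z)| ≤ C * coneWeight X θ x}

/-- Separability of `X` makes continuous functions measurable for the product σ-algebra on `X × Z`.
-/
lemma homogeneousFunctions_subset_growthClass [BorelSpace E] [TopologicalSpace.SeparableSpace X]
    [TopologicalSpace Z] [BorelSpace Z] (hθ : 0 < θ) :
    homogeneousFunctions X Z θ ⊆ growthClass X Z θ := by
  have : SecondCountableTopology X := UniformSpace.secondCountable_of_separable X
  exact fun v hv => ⟨hv.1.measurable, exists_bound_of_mem_homogeneousFunctions hθ hv⟩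

lemma zero_mem_growthClass : (0 : X × Z → ℝ) ∈ growthClass X Z θ :=
  ⟨measurable_const, 0, le_rfl, fun _ _ => by simp⟩

lemma integrable_of_mem_growthClass {v : X × Z → ℝ} (hv : v ∈ growthClass X Z θ) (a : X)
    (μ : Measure Z) [IsFiniteMeasure μ] : Integrable (fun z => v (a, z)) μ :=
  let ⟨C, _, hC⟩ := hv.2
  Integrable.of_bound (hv.1.comp measurable_prodMk_left).aestronglyMeasurable
    (C * coneWeight X θ a) (Eventually.of_forall fun z => hC a z)

lemma exists_abs_sub_le_of_mem_growthClass {v v' : X × Z → ℝ} (hv : v ∈ growthClass X Z θ)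
    (hv' : v' ∈ growthClass X Z θ) :
    ∃ C, 0 ≤ C ∧ ∀ x z, |v (x, z) - v' (x, z)| ≤ C * coneWeight X θ x := by
  obtain ⟨-, C, hC0, hC⟩ := hv
  obtain ⟨-, C', hC0', hC'⟩ := hv'
  refine ⟨C + C', add_nonneg hC0 hC0', fun x z => ?_⟩
  rw [add_mul]
  exact (abs_sub _ _).trans (add_le_add (hC x z) (hC' x z))

end Growth

/-! ### Homogeneous programs -/

namespace ConeProgram

variable {E : Type*} [NormedAddCommGroup E] [NormedSpace ℝ E] [MeasurableSpace E]
  {X : SubMulAction ℝ≥0 E} {Z : Type*} [MeasurableSpace Z]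

lemma aggregator_zero (D : ConeProgram X Z) (s : X × Z) (a : X) : D.aggregator s a 0 = D.u s a := by
  simp [aggregator]

variable [MetricSpace Z]

/-- A program with continuous homogeneous primitives, whose feasible actions and returns grow at
most as fast as `‖x‖` and `‖x‖ ^ θ`. -/
structure IsHomogeneous (D : ConeProgram X Z) (θ M : ℝ) (α c : BoundedMeasurable Z) : Prop where
  pos : 0 < θ
  feller : IsFeller D.Q
  β_cont : Continuous D.β
  β_nonneg : ∀ z, 0 ≤ D.β z
  upper : UpperHemicontinuous D.Γ
  lower : LowerHemicontinuous D.Γ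
  nonempty : ∀ s, (D.Γ s).Nonempty
  compact : ∀ s, IsCompact (D.Γ s)
  Γ_hom : ∀ (x : X) (z : Z), ∀ a ∈ D.Γ (x, z), ∀ γ : ℝ≥0, γ • a ∈ D.Γ (γ • x, z)
  u_cont : ContinuousOn (fun p : (X × Z) × X => D.u p.1 p.2) D.graph
  u_hom : ∀ (x : X) (z : Z), ∀ a ∈ D.Γ (x, z), ∀ γ : ℝ≥0,
    D.u (γ • x, z) (γ • a) = (γ : ℝ) ^ θ * D.u (x, z) a
  bound_nonneg : 0 ≤ M
  u_bound : ∀ (x : X) (z : Z), ∀ a ∈ D.Γ (x, z), |D.u (x, z) a| ≤ M * coneWeight X θ x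
  α_nonneg : ∀ z, 0 ≤ α z
  action_bound : ∀ (x : X) (z : Z), ∀ a ∈ D.Γ (x, z), ‖(a : E)‖ ≤ α z * ‖(x : E)‖
  coeff : ∀ z, c z = D.β z * α z ^ θ

namespace IsHomogeneous

variable {D : ConeProgram X Z} {θ M : ℝ} {α c : BoundedMeasurable Z} {v v' : X × Z → ℝ}
  {x : X} {z : Z} {a : X}

lemma coeff_nonneg (hD : D.IsHomogeneous θ M α c) (z : Z) : 0 ≤ c z := by
  rw [hD.coeff]
  exact mul_nonneg (hD.β_nonneg z) (Real.rpow_nonneg (hD.α_nonneg z) _)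

/-- The source of the coefficient `β α ^ θ`: the growth restriction raised to the power `θ` trades
the weight of the action for that of the state. -/
lemma discount_mul_weight_le (hD : D.IsHomogeneous θ M α c) (ha : a ∈ D.Γ (x, z)) :
    D.β z * coneWeight X θ a ≤ c z * coneWeight X θ x := by
  rw [hD.coeff, mul_assoc]
  refine mul_le_mul_of_nonneg_left ?_ (hD.β_nonneg z)
  rw [coneWeight, coneWeight, ← Real.mul_rpow (hD.α_nonneg z) (norm_nonneg _)]
  exact Real.rpow_le_rpow (norm_nonneg _) (hD.action_bound x z a ha) hD.pos.le

lemma aggregator_smul (hD : D.IsHomogeneous θ M α c) (hv : v ∈ homogeneousFunctions X Z θ)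
    (ha : a ∈ D.Γ (x, z)) (γ : ℝ≥0) :
    D.aggregator (γ • x, z) (γ • a) v = (γ : ℝ) ^ θ * D.aggregator (x, z) a v := by
  simp only [aggregator, hv.2.1, integral_const_mul, hD.u_hom x z a ha]
  ring

variable [IsMarkovKernel D.Q]

lemma discountOperator_nonneg (hD : D.IsHomogeneous θ M α c) (h : BoundedMeasurable Z)
    (hh : ∀ z, 0 ≤ h z) (z : Z) : 0 ≤ discountOperator c D.Q h z := by
  rw [discountOperator_apply]
  exact mul_nonneg (hD.coeff_nonneg z) (integral_nonneg hh)

lemma abs_aggregator_sub_le (hD : D.IsHomogeneous θ M α c) (hv : v ∈ growthClass X Z θ)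
    (hv' : v' ∈ growthClass X Z θ) {h : BoundedMeasurable Z} (hh : ∀ z, 0 ≤ h z)
    (hd : ∀ x z, |v (x, z) - v' (x, z)| ≤ h z * coneWeight X θ x) (ha : a ∈ D.Γ (x, z)) :
    |D.aggregator (x, z) a v - D.aggregator (x, z) a v'| ≤
      discountOperator c D.Q h z * coneWeight X θ x := by
  have hint : |∫ z', v (a, z') ∂(D.Q z) - ∫ z', v' (a, z') ∂(D.Q z)| ≤
      (∫ z', h z' ∂(D.Q z)) * coneWeight X θ a := by
    rw [← integral_sub (integrable_of_mem_growthClass hv a _)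
      (integrable_of_mem_growthClass hv' a _), ← integral_mul_const]
    exact norm_integral_le_of_norm_le (f := fun z' => v (a, z') - v' (a, z'))
      ((BoundedMeasurable.integrable h _).mul_const _)
      (Eventually.of_forall fun z' => hd a z')
  rw [discountOperator_apply, aggregator, aggregator, add_sub_add_left_eq_sub, ← mul_sub, abs_mul,
    abs_of_nonneg (hD.β_nonneg z)]
  have hi : 0 ≤ ∫ z', h z' ∂(D.Q z) := integral_nonneg hh
  calc D.β z * |∫ z', v (a, z') ∂(D.Q z) - ∫ z', v' (a, z') ∂(D.Q z)|
      ≤ D.β z * ((∫ z', h z' ∂(D.Q z)) * coneWeight X θ a) :=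
        mul_le_mul_of_nonneg_left hint (hD.β_nonneg z)
    _ = (D.β z * coneWeight X θ a) * ∫ z', h z' ∂(D.Q z) := by ring
    _ ≤ (c z * coneWeight X θ x) * ∫ z', h z' ∂(D.Q z) :=
        mul_le_mul_of_nonneg_right (hD.discount_mul_weight_le ha) hi
    _ = _ := by ring

/-- Comparison with the zero function, for which the aggregator is `u`; the difference is governed
by `L` applied to a constant. -/
lemma exists_abs_aggregator_le (hD : D.IsHomogeneous θ M α c) (hv : v ∈ growthClass X Z θ) :
    ∃ C, 0 ≤ C ∧ ∀ x z, ∀ a ∈ D.Γ (x, z), |D.aggregator (x, z) a v| ≤ C * coneWeight X θ x := by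
  obtain ⟨C, hC0, hC⟩ := hv.2
  set Lh := discountOperator c D.Q (BoundedMeasurable.const C)
  refine ⟨M + ‖Lh‖, add_nonneg hD.bound_nonneg (norm_nonneg _), fun x z a ha => ?_⟩
  have h1 := hD.abs_aggregator_sub_le hv zero_mem_growthClass (h := BoundedMeasurable.const C)
    (fun _ => hC0) (fun x z => by simpa using hC x z) ha
  rw [aggregator_zero] at h1
  have h2 := hD.u_bound x z a ha
  have h3 := mul_le_mul_of_nonneg_right
    ((le_abs_self _).trans (BoundedMeasurable.abs_le_norm Lh z)) (coneWeight_nonneg (θ := θ) x)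
  have h4 := abs_sub_abs_le_abs_sub (D.aggregator (x, z) a v) (D.u (x, z) a)
  rw [add_mul]
  linarith

lemma aggregator_mono (hD : D.IsHomogeneous θ M α c) (hv : v ∈ growthClass X Z θ)
    (hv' : v' ∈ growthClass X Z θ) (h : v ≤ v') (s : X × Z) (a : X) :
    D.aggregator s a v ≤ D.aggregator s a v' := by
  have := integral_mono (integrable_of_mem_growthClass hv a (D.Q s.2))
    (integrable_of_mem_growthClass hv' a (D.Q s.2)) fun z' => h (a, z')
  exact add_le_add le_rfl (mul_le_mul_of_nonneg_left this (hD.β_nonneg s.2))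

variable [BorelSpace Z]

/-- Although `v` may be unbounded, its growth bounds it uniformly in `z` over the unit ball around
any action, which suffices for `IsFeller.continuous_integral`. -/
lemma continuousOn_aggregator (hD : D.IsHomogeneous θ M α c)
    (hv : v ∈ homogeneousFunctions X Z θ) :
    ContinuousOn (fun p : (X × Z) × X => D.aggregator p.1 p.2 v) {p | p.2 ∈ D.Γ p.1} := by
  obtain ⟨C, hC0, hC⟩ := exists_bound_of_mem_homogeneousFunctions hD.pos hv
  have hint := hD.feller.continuous_integral hv.1 fun a₀ =>
    ⟨1, one_pos, C * (‖(a₀ : E)‖ + 1) ^ θ, fun a ha z => (hC a z).trans <| by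
      refine mul_le_mul_of_nonneg_left
        (Real.rpow_le_rpow (norm_nonneg _) ?_ hD.pos.le) hC0
      have h1 := norm_sub_norm_le (a : E) a₀
      rw [← dist_eq_norm, ← Subtype.dist_eq] at h1
      linarith⟩
  have hpair : Continuous fun p : (X × Z) × X => (p.2, p.1.2) := by fun_prop
  exact hD.u_cont.add ((hD.β_cont.comp (continuous_snd.comp continuous_fst)).mul
    (hint.comp hpair)).continuousOn

lemma isGreatest_bellmanOp (hD : D.IsHomogeneous θ M α c) (hv : v ∈ homogeneousFunctions X Z θ)
    (s : X × Z) : IsGreatest ((fun a => D.aggregator s a v) '' D.Γ s) (D.bellmanOp v s) :=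
  isGreatest_iSup_of_continuousOn_graph hD.compact hD.nonempty (hD.continuousOn_aggregator hv) s

lemma aggregator_le_bellmanOp (hD : D.IsHomogeneous θ M α c)
    (hv : v ∈ homogeneousFunctions X Z θ) {s : X × Z} (ha : a ∈ D.Γ s) :
    D.aggregator s a v ≤ D.bellmanOp v s :=
  (hD.isGreatest_bellmanOp hv s).2 ⟨a, ha, rfl⟩

lemma exists_aggregator_eq_bellmanOp (hD : D.IsHomogeneous θ M α c)
    (hv : v ∈ homogeneousFunctions X Z θ) (s : X × Z) :
    ∃ a ∈ D.Γ s, D.aggregator s a v = D.bellmanOp v s :=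
  (hD.isGreatest_bellmanOp hv s).1

lemma continuous_bellmanOp (hD : D.IsHomogeneous θ M α c)
    (hv : v ∈ homogeneousFunctions X Z θ) : Continuous (D.bellmanOp v) :=
  continuous_iSup_of_hemicontinuous hD.upper hD.lower hD.compact hD.nonempty
    (hD.continuousOn_aggregator hv)

lemma rpow_mul_bellmanOp_le (hD : D.IsHomogeneous θ M α c)
    (hv : v ∈ homogeneousFunctions X Z θ) (γ : ℝ≥0) (x : X) (z : Z) :
    (γ : ℝ) ^ θ * D.bellmanOp v (x, z) ≤ D.bellmanOp v (γ • x, z) := by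
  obtain ⟨a, ha, h⟩ := hD.exists_aggregator_eq_bellmanOp hv (x, z)
  rw [← h, ← hD.aggregator_smul hv ha]
  exact hD.aggregator_le_bellmanOp hv (hD.Γ_hom x z a ha γ)

variable [BorelSpace E] [TopologicalSpace.SeparableSpace X]

lemma measurable_policyOp (hD : D.IsHomogeneous θ M α c) (σ : D.Policy) (hv : Measurable v) :
    Measurable (D.policyOp σ v) := by
  have : SecondCountableTopology X := UniformSpace.secondCountable_of_separable X
  -- `u` is continuous only on the graph, so the composition factors through the graph as a subtype.
  have hu : Measurable fun s => D.u s (σ.1 s) := by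
    have h1 : Measurable fun s => (⟨(s, σ.1 s), σ.2.2 s⟩ : D.graph) :=
      (measurable_id.prodMk σ.2.1).subtype_mk
    exact (continuousOn_iff_continuous_domRestrict.1 hD.u_cont).measurable.comp h1
  have hint : Measurable fun p : X × Z => ∫ z', v (p.1, z') ∂(D.Q p.2) := by
    have h1 : Measurable fun q : (X × Z) × Z => v (q.1.1, q.2) := by fun_prop
    exact (h1.stronglyMeasurable.integral_kernel_prod_right'
      (κ := D.Q.comap Prod.snd measurable_snd)).measurable
  exact hu.add ((hD.β_cont.measurable.comp measurable_snd).mul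
    (hint.comp (σ.2.1.prodMk measurable_snd)))

lemma isWeightedContraction_policyOp (hD : D.IsHomogeneous θ M α c) (σ : D.Policy) :
    IsWeightedContraction (coneWeight X θ) (discountOperator c D.Q) (growthClass X Z θ)
      (D.policyOp σ) where
  weight_nonneg := coneWeight_nonneg
  map_nonneg := hD.discountOperator_nonneg
  mapsTo _ hv :=
    let ⟨C, hC0, hC⟩ := hD.exists_abs_aggregator_le hv
    ⟨hD.measurable_policyOp σ hv.1, C, hC0, fun x z => hC x z _ (σ.2.2 _)⟩
  abs_sub_le _ hv _ hv' _ hh hd x z := hD.abs_aggregator_sub_le hv hv' hh hd (σ.2.2 (x, z))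

lemma exists_abs_bellmanOp_le (hD : D.IsHomogeneous θ M α c)
    (hv : v ∈ homogeneousFunctions X Z θ) :
    ∃ C, ∀ x z, |D.bellmanOp v (x, z)| ≤ C * coneWeight X θ x := by
  obtain ⟨C, -, hC⟩ :=
    hD.exists_abs_aggregator_le (homogeneousFunctions_subset_growthClass hD.pos hv)
  refine ⟨C, fun x z => ?_⟩
  obtain ⟨a, ha, h⟩ := hD.exists_aggregator_eq_bellmanOp hv (x, z)
  rw [← h]
  exact hC x z a ha

/-- Scaling a maximizer gives one inequality, and for `γ ≠ 0` its use at `γ⁻¹` gives the other. At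
`γ = 0` the growth bound forces the value zero. -/
lemma bellmanOp_smul (hD : D.IsHomogeneous θ M α c) (hv : v ∈ homogeneousFunctions X Z θ)
    (γ : ℝ≥0) (x : X) (z : Z) :
    D.bellmanOp v (γ • x, z) = (γ : ℝ) ^ θ * D.bellmanOp v (x, z) := by
  rcases eq_or_ne γ 0 with rfl | hγ
  · obtain ⟨C, hC⟩ := hD.exists_abs_bellmanOp_le hv
    have h := hC ((0 : ℝ≥0) • x) z
    rw [coneWeight_eq_zero hD.pos (by rw [norm_coe_smul, NNReal.coe_zero, zero_mul]),
      mul_zero] at h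
    rw [NNReal.coe_zero, Real.zero_rpow hD.pos.ne', zero_mul]
    exact abs_nonpos_iff.1 h
  · refine le_antisymm ?_ (hD.rpow_mul_bellmanOp_le hv γ x z)
    have h := hD.rpow_mul_bellmanOp_le hv γ⁻¹ (γ • x) z
    have hpos : (0 : ℝ) < (γ : ℝ) ^ θ := Real.rpow_pos_of_pos (by positivity) _
    rw [inv_smul_smul₀ hγ, NNReal.coe_inv, Real.inv_rpow γ.coe_nonneg,
      inv_mul_le_iff₀ hpos] at h
    exact h

lemma mapsTo_bellmanOp (hD : D.IsHomogeneous θ M α c) :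
    MapsTo D.bellmanOp (homogeneousFunctions X Z θ) (homogeneousFunctions X Z θ) := fun v hv =>
  let ⟨C, hC⟩ := hD.exists_abs_bellmanOp_le hv
  ⟨hD.continuous_bellmanOp hv, hD.bellmanOp_smul hv, C, fun x z hx => by
    simpa [coneWeight, hx] using hC x z⟩

/-- Maxima inherit a uniform bound on the difference of the functions: compare both aggregators at
the maximizer of each. -/
lemma isWeightedContraction_bellmanOp (hD : D.IsHomogeneous θ M α c) :
    IsWeightedContraction (coneWeight X θ) (discountOperator c D.Q) (homogeneousFunctions X Z θ)
      D.bellmanOp where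
  weight_nonneg := coneWeight_nonneg
  map_nonneg := hD.discountOperator_nonneg
  mapsTo := hD.mapsTo_bellmanOp
  abs_sub_le v hv v' hv' _ hh hd x z := by
    have hle {a : X} (ha : a ∈ D.Γ (x, z)) := abs_le.1 <| hD.abs_aggregator_sub_le
      (homogeneousFunctions_subset_growthClass hD.pos hv)
      (homogeneousFunctions_subset_growthClass hD.pos hv') hh hd ha
    obtain ⟨a, ha, h1⟩ := hD.exists_aggregator_eq_bellmanOp hv (x, z)
    obtain ⟨b, hb, h2⟩ := hD.exists_aggregator_eq_bellmanOp hv' (x, z)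
    have h3 := hD.aggregator_le_bellmanOp hv hb
    have h4 := hD.aggregator_le_bellmanOp hv' ha
    have h5 := (hle ha).2
    have h6 := (hle hb).1
    exact abs_le.2 ⟨by linarith, by linarith⟩

/-- A measurable policy attains the maximum in the Bellman equation. -/
lemma exists_policyOp_eq_bellmanOp (hD : D.IsHomogeneous θ M α c)
    (hv : v ∈ homogeneousFunctions X Z θ) : ∃ σ : D.Policy, D.policyOp σ v = D.bellmanOp v := by
  have : SecondCountableTopology X := UniformSpace.secondCountable_of_separable X
  -- On the graph `F ≤ 0`, with equality exactly at maximizers, so the argmax is a superlevel set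
  -- and meets a closed set for a closed set of states.
  set F : (X × Z) × X → ℝ := fun p => D.aggregator p.1 p.2 v - D.bellmanOp v p.1
  have hF : ContinuousOn F {p | p.2 ∈ D.Γ p.1} := (hD.continuousOn_aggregator hv).sub
    ((hD.continuous_bellmanOp hv).comp continuous_fst).continuousOn
  have hmeet {C : Set X} (hC : IsClosed C) :
      IsClosed {s | ((D.Γ s ∩ {a | 0 ≤ F (s, a)}) ∩ C).Nonempty} := by
    convert isClosed_setOf_exists_le_of_upperHemicontinuous hD.upper hD.compact hF hC 0 using 1
    ext s
    exact ⟨fun ⟨a, ⟨h1, h2⟩, h3⟩ => ⟨a, h1, h3, h2⟩, fun ⟨a, h1, h3, h2⟩ => ⟨a, ⟨h1, h2⟩, h3⟩⟩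
  have hcompact (s) : IsCompact (D.Γ s ∩ {a | 0 ≤ F (s, a)}) := by
    have h1 : ContinuousOn (fun a => F (s, a)) (D.Γ s) :=
      hF.comp (Continuous.prodMk_right s).continuousOn fun a ha => ha
    exact (hD.compact s).of_isClosed_subset
      (h1.preimage_isClosed_of_isClosed (hD.compact s).isClosed isClosed_Ici) inter_subset_left
  have hne (s) : (D.Γ s ∩ {a | 0 ≤ F (s, a)}).Nonempty := by
    obtain ⟨a, ha, h⟩ := hD.exists_aggregator_eq_bellmanOp hv s
    exact ⟨a, ha, (sub_eq_zero.2 h).ge⟩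
  obtain ⟨σ, hσ, hmem⟩ := exists_measurable_selection hne hcompact
    fun C hC => (hmeet hC).measurableSet
  refine ⟨⟨σ, hσ, fun s => (hmem s).1⟩, funext fun s => ?_⟩
  exact le_antisymm (hD.aggregator_le_bellmanOp hv (hmem s).1) (sub_nonneg.1 (hmem s).2)

lemma exists_fixedPt_bellmanOp (hD : D.IsHomogeneous θ M α c)
    (hL : Summable fun n : ℕ => ‖discountOperator c D.Q ^ n‖) :
    ∃ v ∈ homogeneousFunctions X Z θ, D.bellmanOp v = v := by
  have hT := hD.isWeightedContraction_bellmanOp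
  have h0 : (0 : X × Z → ℝ) ∈ homogeneousFunctions X Z θ := zero_mem_homogeneousFunctions
  have hsub := homogeneousFunctions_subset_growthClass (X := X) (Z := Z) hD.pos
  obtain ⟨C, hC0, hC⟩ := exists_abs_sub_le_of_mem_growthClass (hsub (hT.mapsTo h0)) (hsub h0)
  obtain ⟨v, ε, hε, hd⟩ := hT.exists_limit hL h0 hC0 hC
  have hv := mem_homogeneousFunctions_of_limit hD.pos (hT.iterate_mem h0) hε hd
  exact ⟨v, hv, hT.isFixedPt_limit h0 hv hε hd⟩

/-- The iterates from zero converge relative to the weight. Any other terminal value in the class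
lies at finite weighted distance from zero, which the powers of `L` wipe out. -/
lemma exists_lifetimeValue (hD : D.IsHomogeneous θ M α c)
    (hL : Summable fun n : ℕ => ‖discountOperator c D.Q ^ n‖) (σ : D.Policy) :
    D.lifetimeValue σ ∈ growthClass X Z θ ∧ D.policyOp σ (D.lifetimeValue σ) = D.lifetimeValue σ ∧
      ∀ v ∈ growthClass X Z θ, ∀ s,
        Tendsto (fun n => (D.policyOp σ)^[n] v s) atTop (𝓝 (D.lifetimeValue σ s)) := by
  have hT := hD.isWeightedContraction_policyOp σ
  have h0 : (0 : X × Z → ℝ) ∈ growthClass X Z θ := zero_mem_growthClass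
  obtain ⟨C, hC0, hC⟩ := exists_abs_sub_le_of_mem_growthClass (hT.mapsTo h0) h0
  obtain ⟨v, ε, hε, hd⟩ := hT.exists_limit hL h0 hC0 hC
  have hlim (s : X × Z) : Tendsto (fun n => (D.policyOp σ)^[n] 0 s) atTop (𝓝 (v s)) := by
    rw [tendsto_iff_norm_sub_tendsto_zero]
    refine squeeze_zero (fun n => norm_nonneg _) (fun n => hd n s.1 s.2) ?_
    simpa using hε.mul_const (coneWeight X θ s.1)
  have hv_eq : D.lifetimeValue σ = v := funext fun s => (hlim s).limUnder_eq
  have hv : v ∈ growthClass X Z θ := by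
    refine ⟨measurable_of_tendsto_metrizable (fun n => (hT.iterate_mem h0 n).1)
      (tendsto_pi_nhds.2 hlim), |ε 0|, abs_nonneg _, fun x z => ?_⟩
    have := hd 0 x z
    rw [Function.iterate_zero_apply, Pi.zero_apply, zero_sub, abs_neg] at this
    exact this.trans (mul_le_mul_of_nonneg_right (le_abs_self _) (coneWeight_nonneg x))
  rw [hv_eq]
  refine ⟨hv, hT.isFixedPt_limit h0 hv hε hd, fun v' hv' s => ?_⟩
  obtain ⟨C', hC0', hC'⟩ := exists_abs_sub_le_of_mem_growthClass hv' h0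
  simpa using (hT.tendsto_iterate_sub hL hv' h0 hC0' hC' s).add (hlim s)

lemma lifetimeValue_eq_of_policyOp_eq (hD : D.IsHomogeneous θ M α c)
    (hL : Summable fun n : ℕ => ‖discountOperator c D.Q ^ n‖) {σ : D.Policy}
    (hv : v ∈ growthClass X Z θ) (h : D.policyOp σ v = v) : D.lifetimeValue σ = v := by
  funext s
  have := (hD.exists_lifetimeValue hL σ).2.2 v hv s
  simp only [Function.iterate_fixed h] at this
  exact tendsto_nhds_unique this tendsto_const_nhds

/-- Monotonicity of `T_σ` keeps all iterates from `v` below `v`. -/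
lemma lifetimeValue_le_of_policyOp_le (hD : D.IsHomogeneous θ M α c)
    (hL : Summable fun n : ℕ => ‖discountOperator c D.Q ^ n‖) {σ : D.Policy}
    (hv : v ∈ growthClass X Z θ) (h : D.policyOp σ v ≤ v) : D.lifetimeValue σ ≤ v := by
  have hT := hD.isWeightedContraction_policyOp σ
  have hle (n : ℕ) : (D.policyOp σ)^[n] v ≤ v := by
    induction n with
    | zero => exact le_rfl
    | succ n ih =>
      rw [Function.iterate_succ_apply']
      exact le_trans (fun s => hD.aggregator_mono (hT.iterate_mem hv n) hv ih s _) h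
  exact fun s => le_of_tendsto' ((hD.exists_lifetimeValue hL σ).2.2 v hv s) fun n => hle n s

/-- The value of every policy is at most the fixed point of the Bellman operator, with equality
for the policies that attain the maximum. -/
lemma isGreatest_lifetimeValue (hD : D.IsHomogeneous θ M α c)
    (hL : Summable fun n : ℕ => ‖discountOperator c D.Q ^ n‖)
    (hv : v ∈ homogeneousFunctions X Z θ) (hfix : D.bellmanOp v = v) :
    IsGreatest (range D.lifetimeValue) v := by
  have hvg := homogeneousFunctions_subset_growthClass hD.pos hv
  constructor
  · obtain ⟨σ, hσ⟩ := hD.exists_policyOp_eq_bellmanOp hv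
    exact ⟨σ, hD.lifetimeValue_eq_of_policyOp_eq hL hvg (hσ.trans hfix)⟩
  · rintro _ ⟨σ, rfl⟩
    exact hD.lifetimeValue_le_of_policyOp_le hL hvg fun s =>
      (hD.aggregator_le_bellmanOp hv (σ.2.2 s)).trans_eq (congrFun hfix s)

end IsHomogeneous

end ConeProgram
-- Optimality for homogeneous programs
theorem propositionp {E : Type*} [NormedAddCommGroup E] [NormedSpace ℝ E] [MeasurableSpace E]
    [BorelSpace E] (X : SubMulAction ℝ≥0 E) [TopologicalSpace.SeparableSpace X]
    {Z : Type*} [MetricSpace Z] [MeasurableSpace Z] [BorelSpace Z]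
    (θ : ℝ) (hθ_pos : 0 < θ) (hθ_le : θ ≤ 1)
    (D : ConeProgram X Z) [IsMarkovKernel D.Q] (hFeller : IsFeller D.Q)
    (hβ_cont : Continuous D.β) (hβ_nonneg : ∀ z, 0 ≤ D.β z)
    -- the feasible correspondence
    (hΓ_upper : UpperHemicontinuous D.Γ) (hΓ_lower : LowerHemicontinuous D.Γ)
    (hΓ_nonempty : ∀ s, (D.Γ s).Nonempty) (hΓ_compact : ∀ s, IsCompact (D.Γ s))
    (hΓ_hom : ∀ (x : X) (z : Z), ∀ a ∈ D.Γ (x, z), ∀ γ : ℝ≥0, γ • a ∈ D.Γ (γ • x, z))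
    -- the return function
    (hu_cont : ContinuousOn (fun p : (X × Z) × X => D.u p.1 p.2) D.graph)
    (hu_hom : ∀ (x : X) (z : Z), ∀ a ∈ D.Γ (x, z), ∀ γ : ℝ≥0,
      D.u (γ • x, z) (γ • a) = (γ : ℝ) ^ θ * D.u (x, z) a)
    (hu_bound : ∃ B : ℝ, 0 < B ∧ ∀ (x : X) (z : Z), ∀ a ∈ D.Γ (x, z),
      |D.u (x, z) a| ≤ B * (‖(x : E)‖ + ‖(a : E)‖) ^ θ)
    -- the growth restriction
    (α : BoundedMeasurable Z) (hα_nonneg : ∀ z, 0 ≤ α z)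
    (hα : ∀ (x : X) (z : Z), ∀ a ∈ D.Γ (x, z), ‖(a : E)‖ ≤ α z * ‖(x : E)‖)
    -- the spectral radius condition for `h ↦ β α ^ θ ∫ h dQ`
    (c : BoundedMeasurable Z) (hc : ∀ z, c z = D.β z * α z ^ θ)
    (hr : ∃ r : ℝ, IsSpectralRadius (discountOperator c D.Q) r ∧ r < 1) :
    -- every lifetime value is well defined and finite
    (∀ σ : D.Policy, D.LifetimeValueWellDefined (homogeneousFunctions X Z θ) σ) ∧
    -- the value function is a well-defined real-valued supremum
    Nonempty D.Policy ∧
    (∀ s, IsLUB (range fun σ : D.Policy => D.lifetimeValue σ s) (D.valueFunction s)) ∧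
    -- `T` is a self-map of the candidate space, and the value function is its unique fixed point
    MapsTo D.bellmanOp (homogeneousFunctions X Z θ) (homogeneousFunctions X Z θ) ∧
    D.valueFunction ∈ homogeneousFunctions X Z θ ∧
    D.bellmanOp D.valueFunction = D.valueFunction ∧
    (∀ v ∈ homogeneousFunctions X Z θ, D.bellmanOp v = v → v = D.valueFunction) ∧
    -- value function iteration converges in norm
    (∀ v ∈ homogeneousFunctions X Z θ,
      Tendsto (fun n : ℕ => sphereNorm (D.bellmanOp^[n] v - D.valueFunction)) atTop (𝓝 0)) ∧
    -- an optimal stationary policy exists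
    (∃ σ : D.Policy, D.IsOptimal σ) ∧
    -- the principle of optimality
    (∀ σ : D.Policy, D.IsOptimal σ ↔
      ∀ s, σ.1 s ∈ D.Γ s ∧ IsMaxOn (fun a => D.aggregator s a D.valueFunction) (D.Γ s) (σ.1 s)) := by
  obtain ⟨B, hB0, hB⟩ := hu_bound
  -- The constant comes from `‖x‖ + ‖a‖ ≤ (1 + ‖α‖)‖x‖` for feasible `a`.
  have hD : D.IsHomogeneous θ (B * (1 + ‖α‖) ^ θ) α c :=
    { pos := hθ_pos
      feller := hFeller
      β_cont := hβ_cont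
      β_nonneg := hβ_nonneg
      upper := hΓ_upper
      lower := hΓ_lower
      nonempty := hΓ_nonempty
      compact := hΓ_compact
      Γ_hom := hΓ_hom
      u_cont := hu_cont
      u_hom := hu_hom
      bound_nonneg := by positivity
      u_bound := fun x z a ha => (hB x z a ha).trans <| by
        rw [coneWeight, mul_assoc, ← Real.mul_rpow (by positivity) (norm_nonneg _)]
        refine mul_le_mul_of_nonneg_left (Real.rpow_le_rpow (by positivity) ?_ hθ_pos.le) hB0.le
        have h1 := mul_le_mul_of_nonneg_right
          ((le_abs_self _).trans (BoundedMeasurable.abs_le_norm α z)) (norm_nonneg (x : E))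
        linarith [hα x z a ha]
      α_nonneg := hα_nonneg
      action_bound := hα
      coeff := hc }
  obtain ⟨r, hr, hr1⟩ := hr
  have hL := hr.summable_norm_pow hr1
  have hT := hD.isWeightedContraction_bellmanOp
  have hsub : homogeneousFunctions X Z θ ⊆ growthClass X Z θ :=
    homogeneousFunctions_subset_growthClass hθ_pos
  obtain ⟨w, hw, hfix⟩ := hD.exists_fixedPt_bellmanOp hL
  obtain ⟨⟨σ₀, hσ₀⟩, hupper⟩ := hD.isGreatest_lifetimeValue hL hw hfix
  have hgreatest (s : X × Z) : IsGreatest (range fun σ : D.Policy => D.lifetimeValue σ s) (w s) :=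
    ⟨⟨σ₀, congrFun hσ₀ s⟩, by rintro _ ⟨σ, rfl⟩; exact hupper ⟨σ, rfl⟩ s⟩
  have hvalue : D.valueFunction = w := by
    have : Nonempty D.Policy := ⟨σ₀⟩
    exact funext fun s => (hgreatest s).isLUB.csSup_eq (range_nonempty _)
  have hoptimal (σ : D.Policy) : D.IsOptimal σ ↔ D.lifetimeValue σ = w := by
    rw [ConeProgram.IsOptimal, hvalue, funext_iff]
  rw [hvalue]
  refine ⟨fun σ v₀ hv₀ => ⟨fun n => ?_, fun n a z => ?_, ?_⟩, ⟨σ₀⟩, fun s => (hgreatest s).isLUB,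
    hT.mapsTo, hw, hfix, fun v hv hvfix => ?_, fun v hv => ?_, ⟨σ₀, (hoptimal σ₀).2 hσ₀⟩,
    fun σ => ?_⟩
  · exact ((hD.isWeightedContraction_policyOp σ).iterate_mem (hsub hv₀) n).1
  · exact integrable_of_mem_growthClass
      ((hD.isWeightedContraction_policyOp σ).iterate_mem (hsub hv₀) n) a _
  · exact (hD.exists_lifetimeValue hL σ).2.2 v₀ (hsub hv₀)
  · obtain ⟨C, hC0, hC⟩ := exists_abs_sub_le_of_mem_growthClass (hsub hv) (hsub hw)
    exact hT.eq_of_isFixedPt hL hv hw hC0 hC hvfix hfix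
  · obtain ⟨C, hC0, hC⟩ := exists_abs_sub_le_of_mem_growthClass (hsub hv) (hsub hw)
    -- The weight equals one on the unit sphere, so the weighted bound `‖L ^ n‖ * C` also bounds
    -- `sphereNorm`.
    refine squeeze_zero (fun n => sphereNorm_nonneg _) (fun n => sphereNorm_le (θ := θ)
      (mul_nonneg (norm_nonneg (discountOperator c D.Q ^ n)) hC0) fun x z => ?_)
      (by simpa using hL.tendsto_atTop_zero.mul_const C)
    have := hT.abs_iterate_sub_le_norm hv hw hC0 hC n x z
    rwa [Function.iterate_fixed hfix] at this
  · rw [hoptimal]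
    constructor
    -- `v_σ` is fixed by `T_σ`, so `v_σ = w` gives `T_σ w = w = T w`: the maximum is attained.
    · intro h s
      have h1 := (hD.exists_lifetimeValue hL σ).2.1
      rw [h] at h1
      refine ⟨σ.2.2 s, fun a ha => ?_⟩
      change D.aggregator s a w ≤ D.policyOp σ w s
      rw [h1]
      exact (hD.aggregator_le_bellmanOp hw ha).trans_eq (congrFun hfix s)
    -- Attainment means `T_σ w = T w = w`, and `v_σ` is the only fixed point of `T_σ` in the growth
    -- class.
    · intro h
      refine hD.lifetimeValue_eq_of_policyOp_eq hL (hsub hw) (funext fun s => ?_)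
      refine (le_antisymm (hD.aggregator_le_bellmanOp hw (σ.2.2 s)) ?_).trans (congrFun hfix s)
      obtain ⟨a, ha, hEq⟩ := hD.exists_aggregator_eq_bellmanOp hw s
      exact hEq.symm.le.trans ((h s).2 ha)
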